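/- Let $\mathbf x=(x_1,x_2,\dots)$ be countably many commuting indeterminates. For a finite graph $G$, let $X_G=\sum_\kappa\prod_{v\in V(G)}x_{\kappa(v)}$ be its chromatic symmetric function, where $\kappa$ runs over the proper colorings of $G$ with positive integers. For $m\ge 2$ and $l\ge 0$, let the tadpole $T_{m,l}$ be the graph on $m+l$ vertices obtained from the disjoint union of the cycle $C_m$ and the path $P_l$ on $l$ vertices by joining a vertex of the cycle and an end of the path by an edge; thus $T_{m,0}=C_m$, and $C_2$ consists of two adjacent vertices (a doubled edge, which for proper colorings is the same as a single edge). For a composition $I=i_1i_2\cdots i_s$ of $n$, i.e. a sequence of positive integers with sum $n$ (written $I\vDash n$), put \[ w_I=i_1\prod_{j\ge2}(i_j-1),\qquad e_I=e_{i_1}e_{i_2}\cdots e_{i_s},\qquad e_k=\sum_{1\le j_1<\dots<j_k}x_{j_1}\cdots x_{j_k}, \] and, for an integer $0\le a\le n$, \[ \Theta^+_I(a)=\min\{\,i_1+\dots+i_k : 0\le k\le s,\ i_1+\dots+i_k\ge a\,\}-a . \] Then for all integers $n$ and $l$ with $0\le l\le n-2$, \[ X_{T_{n-l,l}}=\sum_{I\vDash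 n}\Theta^+_I(l+1)\,w_I\,e_I . \] -/

import Mathlib

namespace ChromSym

/-- The chromatic symmetric function `X_G = ∑_κ ∏_v x_{κ(v)}` of a finite graph, as a formal power
series in countably many commuting indeterminates `x_0, x_1, …`: the coefficient of the monomial
`x^d` is the number of proper colorings `κ : V → ℕ` with `∏_v x_{κ(v)} = x^d`. -/
noncomputable def chromaticSymm {V : Type*} [Fintype V] (G : SimpleGraph V) : MvPowerSeries ℕ ℚ :=
  fun d => (Nat.card {κ : G.Coloring ℕ // ∑ v, Finsupp.single (κ v) 1 = d} : ℚ)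

/-- Only finitely many proper colorings contribute to a given monomial, so that the coefficients of
`chromaticSymm` are genuine counts. -/
theorem finite_colorings {V : Type*} [Fintype V] (G : SimpleGraph V) (d : ℕ →₀ ℕ) :
    Finite {κ : G.Coloring ℕ // ∑ v, Finsupp.single (κ v) 1 = d} := by
  classical
  have hmem : ∀ (κ : {κ : G.Coloring ℕ // ∑ v, Finsupp.single (κ v) 1 = d}) (v : V),
      κ.1 v ∈ d.support := by
    rintro ⟨κ, rfl⟩ v
    rw [Finsupp.mem_support_iff, Finsupp.finsetSum_apply]
    have h : (Finsupp.single (κ v) 1 : ℕ →₀ ℕ) (κ v) ≤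
        ∑ u, (Finsupp.single (κ u) 1 : ℕ →₀ ℕ) (κ v) :=
      Finset.single_le_sum (f := fun u => (Finsupp.single (κ u) 1 : ℕ →₀ ℕ) (κ v))
        (fun _ _ => Nat.zero_le _) (Finset.mem_univ v)
    rw [Finsupp.single_eq_same] at h
    exact Nat.one_le_iff_ne_zero.mp h
  refine Finite.of_injective
    (fun κ => (fun v => (⟨κ.1 v, hmem κ v⟩ : {i // i ∈ d.support}))) ?_
  intro κ κ' h
  apply Subtype.ext
  apply RelHom.ext
  intro v
  exact congrArg Subtype.val (congrFun h v)

/-- The elementary symmetric function `e_k`, the formal sum of all squarefree monomials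
`x_{i_1} ⋯ x_{i_k}` with `i_1 < ⋯ < i_k`. -/
noncomputable def elemSymm (k : ℕ) : MvPowerSeries ℕ ℚ :=
  open scoped Classical in
  fun d => if ∃ s : Finset ℕ, s.card = k ∧ d = ∑ i ∈ s, Finsupp.single i 1 then 1 else 0

/-- `e_I = e_{i_1} e_{i_2} ⋯` for a composition `I = i_1 i_2 ⋯`. -/
noncomputable def elemSymmComp {n : ℕ} (I : Composition n) : MvPowerSeries ℕ ℚ :=
  (I.blocks.map elemSymm).prod

/-- `i_1 ∏_{j ≥ 2} (i_j - 1)` for a list `i_1, i_2, …` (and `1` for the empty list). -/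
def wList : List ℕ → ℤ
  | [] => 1
  | i :: t => (i : ℤ) * (t.map fun j => (j : ℤ) - 1).prod

/-- `w_I = i_1 ∏_{j ≥ 2} (i_j - 1)`. -/
def w {n : ℕ} (I : Composition n) : ℤ := wList I.blocks

/-- The surplus partial sum `σ⁺_I(a)`: the least partial sum `i_1 + ⋯ + i_k`, `0 ≤ k ≤ ℓ(I)`, that is
at least `a`. It is meant for `a ≤ n`, when the set is nonempty. -/
noncomputable def sigmaPlus {n : ℕ} (I : Composition n) (a : ℕ) : ℕ :=
  sInf {s | ∃ k ≤ I.length, s = I.sizeUpTo k ∧ a ≤ s}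

/-- The `a`-surplus `Θ⁺_I(a) = σ⁺_I(a) - a`. -/
noncomputable def ThetaPlus {n : ℕ} (I : Composition n) (a : ℕ) : ℤ :=
  (sigmaPlus I a : ℤ) - a

/-- The tadpole `T_{m,l}` for `m ≥ 2`: the disjoint union of the cycle `C_m` and the path `P_l`
together with an edge that joins the vertex `0` of the cycle and the end `0` of the path (no such
edge for `l = 0`). For `m = 2` the cycle is an edge, the simple graph underlying a doubled edge. -/
def tadpole (m l : ℕ) : SimpleGraph (Fin m ⊕ Fin l) :=
  (SimpleGraph.cycleGraph m ⊕g SimpleGraph.pathGraph l) ⊔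
    SimpleGraph.fromRel fun a b =>
      ∃ (i : Fin m) (j : Fin l), i.val = 0 ∧ j.val = 0 ∧ a = Sum.inl i ∧ b = Sum.inr j

end ChromSym

/-! A fixed monomial involves finitely many variables, so coefficients can be compared in a finite
alphabet, where proper colorings of a tadpole are words. Let P_n be the weight sum of the path on n
vertices and T(m,l) that of the tadpole with cycle length m+1. Relaxing one cycle edge at the
junction gives T(m+1,l) - T(m,l+1) = P_{m+l+2} - P_{l+1} T(m,0) (`tadpoleSum_succ`), and T(0,l) = 0
because a loop has no proper coloring.

For paths, ∑ P_n z^n = E/(E - zE') with E = ∏(1 + x_a z), which expands to P_n = ∑ w_I e_I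
(`pathSum_eq_headSum`).

The sums ∑ Θ⁺_I(l+1) w_I e_I obey the same recurrence (`surplusSum_sub_surplusSum`). Passing from
Θ⁺_I(a+1) to Θ⁺_I(a+2) lowers the surplus by 1, unless a+1 is a partial sum. In that case I = JK
with |J| = a+1, and the surplus rises from 0 to k_1 - 1, so the drop is 1 - k_1. The correction k_1
w_I equals w_J · Θ⁺_K(1) w_K, since Θ⁺_K(1) = k_1 - 1; hence the product term. Induction on m
concludes. -/

namespace ChromSym
-- Word weights and the tadpole recurrence.
section Weights
variable {α R : Type*} [Fintype α] [DecidableEq α] [CommRing R]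

/-- The total weight of the words `b₁ ⋯ b_k` such that `a b₁ ⋯ b_k` has no two equal consecutive
letters. -/
def walkWeight (x : α → R) : ℕ → α → R
  | 0, _ => 1
  | k + 1, a => ∑ b, if a ≠ b then x b * walkWeight x k b else 0

/-- The total weight of the words `b₁ ⋯ b_k` such that `a b₁ ⋯ b_k b` has no two equal consecutive
letters. -/
def loopWeight (x : α → R) : ℕ → α → α → R
  | 0, a, b => if a ≠ b then 1 else 0
  | k + 1, a, b => ∑ c, if a ≠ c then x c * loopWeight x k c b else 0

/-- The chromatic polynomial of the path with `n` vertices, in the variables `x`. -/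
def pathSum (x : α → R) : ℕ → R
  | 0 => 1
  | k + 1 => ∑ a, x a * walkWeight x k a

/-- The chromatic polynomial of the tadpole with cycle length `m + 1` and tail length `l`, in the
variables `x` (and `0` for a loop). -/
def tadpoleSum (x : α → R) (m l : ℕ) : R :=
  ∑ a, x a * loopWeight x m a a * walkWeight x l a

variable (x : α → R)

theorem sum_ite_ne (a : α) (f : α → R) :
    (∑ b, if a ≠ b then f b else 0) = ∑ b, f b - f a := by
  have h : ∑ b, (if a = b then f b else 0) = f a := by simp
  rw [eq_sub_iff_add_eq, ← h, ← Finset.sum_add_distrib]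
  refine Finset.sum_congr rfl fun b _ => ?_
  by_cases h : a = b <;> simp [h]

theorem walkWeight_succ (k : ℕ) (a : α) :
    walkWeight x (k + 1) a = pathSum x (k + 1) - x a * walkWeight x k a :=
  sum_ite_ne a _

theorem loopWeight_succ' (k : ℕ) (a b : α) :
    loopWeight x (k + 1) a b = ∑ c, if c ≠ b then loopWeight x k a c * x c else 0 := by
  induction k generalizing a with
  | zero =>
    simp only [loopWeight]
    refine Finset.sum_congr rfl fun c _ => ?_
    by_cases h : a = c <;> by_cases h' : c = b <;> simp [h, h']
  | succ k ih =>
    rw [loopWeight]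
    simp only [ih]
    have h : ∀ c, (if c ≠ b then loopWeight x (k + 1) a c * x c else 0) =
        ∑ d, if c ≠ b then (if a ≠ d then x d * loopWeight x k d c else 0) * x c else 0 := by
      intro c
      by_cases h : c = b <;> simp [h, loopWeight, Finset.sum_mul]
    simp only [h]
    rw [Finset.sum_comm]
    refine Finset.sum_congr rfl fun d _ => ?_
    by_cases h : a = d
    · simp [h]
    · simp only [ne_eq, h, not_false_eq_true, if_true, Finset.mul_sum]
      refine Finset.sum_congr rfl fun c _ => ?_
      split_ifs <;> ring

theorem loopWeight_comm (k : ℕ) (a b : α) : loopWeight x k a b = loopWeight x k b a := by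
  induction k generalizing a b with
  | zero => simp [loopWeight, eq_comm]
  | succ k ih =>
    rw [loopWeight_succ', loopWeight]
    refine Finset.sum_congr rfl fun c _ => ?_
    rw [ih a c]
    by_cases h : b = c <;> simp [h, eq_comm, mul_comm]

theorem sum_loopWeight_mul (k : ℕ) (a : α) :
    ∑ c, loopWeight x k a c * x c = walkWeight x (k + 1) a := by
  induction k generalizing a with
  | zero =>
    simp only [loopWeight, walkWeight]
    exact Finset.sum_congr rfl fun c _ => by split_ifs <;> simp
  | succ k ih =>
    rw [walkWeight]
    simp only [← ih, loopWeight, Finset.sum_mul]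
    rw [Finset.sum_comm]
    refine Finset.sum_congr rfl fun c _ => ?_
    split_ifs
    · simp only [Finset.mul_sum, mul_assoc]
    · simp

/-- Deletion-contraction at an edge of the cycle through the base letter `a`: dropping the edge
leaves an open walk, and identifying its ends leaves a cycle shorter by one. -/
theorem loopWeight_succ_self (k : ℕ) (a : α) :
    loopWeight x (k + 1) a a = walkWeight x (k + 1) a - x a * loopWeight x k a a := by
  rw [loopWeight, sum_ite_ne, ← sum_loopWeight_mul]
  congr 1
  exact Finset.sum_congr rfl fun c _ => by rw [loopWeight_comm, mul_comm]

/-- Two walks from a common letter form one path. The induction moves the marked letter one step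
along it. -/
theorem sum_walkWeight_mul_walkWeight (m l : ℕ) :
    ∑ a, x a * walkWeight x m a * walkWeight x l a = pathSum x (m + l + 1) := by
  induction m generalizing l with
  | zero => simp [walkWeight, pathSum]
  | succ m ih =>
    rw [show m + 1 + l + 1 = m + (l + 1) + 1 by ring, ← ih]
    simp only [walkWeight, Finset.mul_sum, Finset.sum_mul]
    rw [Finset.sum_comm]
    refine Finset.sum_congr rfl fun b _ => Finset.sum_congr rfl fun a _ => ?_
    by_cases h : a = b
    · simp [h]
    · simp only [ne_eq, h, Ne.symm h, not_false_eq_true, if_true]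
      ring

theorem tadpoleSum_zero (l : ℕ) : tadpoleSum x 0 l = 0 := by
  simp [tadpoleSum, loopWeight]

/-- Opening the cycle yields a path. In the contracted term the spare factor `x a` is absorbed by
the tail, as x_a W_l(a) = P_{l+1} - W_{l+1}(a). -/
theorem tadpoleSum_succ (m l : ℕ) :
    tadpoleSum x (m + 1) l =
      pathSum x (m + l + 2) - pathSum x (l + 1) * tadpoleSum x m 0 + tadpoleSum x m (l + 1) := by
  rw [show m + l + 2 = m + 1 + l + 1 by ring, ← sum_walkWeight_mul_walkWeight]
  simp only [tadpoleSum, Finset.mul_sum]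
  rw [← Finset.sum_sub_distrib, ← Finset.sum_add_distrib]
  refine Finset.sum_congr rfl fun a _ => ?_
  rw [loopWeight_succ_self, walkWeight_succ x l]
  simp only [walkWeight]
  ring

end Weights
end ChromSym

namespace ChromSym
-- Sums over compositions and their surplus recurrence.
section Compositions
variable {R : Type*} [CommRing R]

theorem sum_composition_zero (F : List ℕ → R) : ∑ I : Composition 0, F I.blocks = F [] := by
  have h : ∀ I : Composition 0, I.blocks = [] := fun I =>
    List.eq_nil_iff_forall_not_mem.mpr fun i hi => by
      have h := I.blocks_pos hi
      have h' := List.le_sum_of_mem hi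
      rw [I.blocks_sum] at h'
      omega
  simp [h, composition_card]

/-- Sums over compositions of `n + 1`, split according to the first block. -/
theorem sum_composition_succ (n : ℕ) (F : List ℕ → R) :
    ∑ I : Composition (n + 1), F I.blocks =
      ∑ i ∈ Finset.range (n + 1), ∑ J : Composition (n - i), F ((i + 1) :: J.blocks) := by
  rw [Finset.sum_sigma' (Finset.range (n + 1))
    (fun i => (Finset.univ : Finset (Composition (n - i))))
    (fun i J => F ((i + 1) :: J.blocks))]
  symm
  refine Finset.sum_bij (fun p hp => (⟨(p.1 + 1) :: p.2.blocks, ?_, ?_⟩ : Composition (n + 1)))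
    ?_ ?_ ?_ ?_
  · intro i hi
    rcases List.mem_cons.mp hi with rfl | hi
    · omega
    · exact p.2.blocks_pos hi
  · have h : p.1 < n + 1 := by simpa using hp
    rw [List.sum_cons, p.2.blocks_sum]
    omega
  · simp
  · rintro ⟨i, J⟩ _ ⟨i', J'⟩ _ h
    simp only [Composition.mk.injEq, List.cons.injEq, Nat.add_right_cancel_iff] at h
    obtain ⟨rfl, h⟩ := h
    rw [Composition.ext h]
  · intro I _
    obtain ⟨b, hpos, hsum⟩ := I
    cases b with
    | nil => simp at hsum
    | cons i t =>
      have hi : 0 < i := hpos (by simp)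
      rw [List.sum_cons] at hsum
      obtain ⟨j, rfl⟩ : ∃ j, i = j + 1 := ⟨i - 1, by omega⟩
      exact ⟨⟨j, ⟨t, fun h => hpos (by simp [h]), by omega⟩⟩, by simp; omega, rfl⟩
  · intros; rfl

/-- The surplus `Θ⁺(a)` of a list of block sizes, by recursion on the list. -/
def surplus : List ℕ → ℕ → ℤ
  | [], _ => 0
  | i :: t, a => if a ≤ i then (i : ℤ) - a else surplus t (a - i)

/-- The product of the values of `v` on a list, except that the head is evaluated by `u`. -/
def headProd (u v : ℕ → R) : List ℕ → R
  | [] => 1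
  | i :: t => u i * (t.map v).prod

/-- The sum of `headProd u v` over the compositions of `n`. -/
def headSum (u v : ℕ → R) (n : ℕ) : R := ∑ I : Composition n, headProd u v I.blocks

/-- The sum of `headProd u v` over the compositions `I` of `n`, weighted by `Θ⁺_I(a + 1)`. -/
def surplusSum (u v : ℕ → R) (n a : ℕ) : R :=
  ∑ I : Composition n, (surplus I.blocks (a + 1) : R) * headProd u v I.blocks

variable (u v : ℕ → R)

theorem headProd_self (t : List ℕ) : headProd v v t = (t.map v).prod := by
  cases t <;> simp [headProd]

theorem headSum_zero : headSum u v 0 = 1 := sum_composition_zero _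

theorem headSum_succ (n : ℕ) :
    headSum u v (n + 1) = ∑ i ∈ Finset.range (n + 1), u (i + 1) * headSum v v (n - i) := by
  rw [headSum, sum_composition_succ]
  refine Finset.sum_congr rfl fun i _ => ?_
  simp only [headSum, headProd_self, Finset.mul_sum]
  rfl

theorem surplusSum_succ (n a : ℕ) :
    surplusSum u v (n + 1) a = ∑ i ∈ Finset.range (n + 1), u (i + 1) *
      if a ≤ i then ((i : R) - a) * headSum v v (n - i)
      else surplusSum v v (n - i) (a - i - 1) := by
  rw [surplusSum, sum_composition_succ (F := fun t => (surplus t (a + 1) : R) * headProd u v t)]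
  refine Finset.sum_congr rfl fun i _ => ?_
  split_ifs with h
  · simp only [headSum, headProd_self, Finset.mul_sum]
    refine Finset.sum_congr rfl fun J _ => ?_
    simp only [surplus, headProd, Nat.add_le_add_iff_right, h, if_true]
    push_cast
    ring
  · simp only [surplusSum, headProd_self, Finset.mul_sum]
    refine Finset.sum_congr rfl fun J _ => ?_
    simp only [surplus, headProd, Nat.add_le_add_iff_right, h, if_false]
    rw [show a + 1 - (i + 1) = a - i - 1 + 1 by omega]
    ring

theorem surplusSum_zero (n : ℕ) :
    surplusSum u v (n + 1) 0 =
      ∑ i ∈ Finset.range (n + 1), u (i + 1) * (i * headSum v v (n - i)) := by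
  rw [surplusSum_succ]
  simp

/-- The least partial sum reaching the whole size is the size itself, so every surplus vanishes.
This matches the loop case `tadpoleSum_zero`. -/
theorem surplusSum_self (n : ℕ) : surplusSum u v (n + 1) n = 0 := by
  induction n using Nat.strong_induction_on generalizing u with
  | _ n ih =>
    rw [surplusSum_succ]
    refine Finset.sum_eq_zero fun i hi => ?_
    have hi' : i < n + 1 := by simpa using hi
    split_ifs with h
    · obtain rfl : n = i := by omega
      simp
    · rw [show n - i = n - i - 1 + 1 by omega, Nat.add_sub_cancel, ih _ (by omega), mul_zero]

variable {v} {w : ℕ → R}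

/-- Inductive step, comparing terms by the first block i+1. It is used with w_i = i e_i and v_i =
(i-1) e_i, for which `hw` is immediate. -/
theorem surplusSum_sub_surplusSum_of_tail (hw : ∀ i : ℕ, (i : R) * w (i + 1) = (i + 1) * v (i + 1))
    (n a : ℕ) (ha : a < n)
    (ih : ∀ i < a, surplusSum v v (n - i) (a - i - 1) - surplusSum v v (n - i) (a - i) =
      headSum v v (n - i) - headSum v v (a - i) * surplusSum w v (n - a) 0) :
    surplusSum u v (n + 1) a - surplusSum u v (n + 1) (a + 1) =
      headSum u v (n + 1) - headSum u v (a + 1) * surplusSum w v (n - a) 0 := by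
  -- With first block i+1, the surplus at 1 is i, and i w_{i+1} = v_{i+1} + i v_{i+1}.
  have hT : surplusSum w v (n - a) 0 = headSum v v (n - a) + surplusSum v v (n - a) 0 := by
    obtain ⟨k, hk⟩ : ∃ k, n - a = k + 1 := ⟨n - a - 1, by omega⟩
    rw [hk, surplusSum_zero, surplusSum_zero, headSum_succ, ← Finset.sum_add_distrib]
    refine Finset.sum_congr rfl fun i _ => ?_
    linear_combination headSum v v (k - i) * hw i
  have hs : headSum u v (a + 1) = ∑ i ∈ Finset.range (n + 1),
      if i < a + 1 then u (i + 1) * headSum v v (a - i) else 0 := by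
    rw [headSum_succ, ← Finset.sum_filter]
    refine Finset.sum_congr ?_ fun _ _ => rfl
    ext i
    simp only [Finset.mem_range, Finset.mem_filter]
    omega
  rw [surplusSum_succ, surplusSum_succ, hs, headSum_succ, Finset.sum_mul,
    ← Finset.sum_sub_distrib, ← Finset.sum_sub_distrib]
  refine Finset.sum_congr rfl fun i _ => ?_
  -- The first block ends before a+1 (both surpluses pass to the tail), exactly at a+1 (only the
  -- second does), or beyond it (they differ by 1).
  rcases lt_trichotomy i a with h | rfl | h
  · rw [if_neg (by omega), if_neg (by omega), if_pos (by omega),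
      show a + 1 - i - 1 = a - i by omega]
    linear_combination u (i + 1) * ih i h
  · rw [if_pos le_rfl, if_neg (by omega), if_pos (by omega), hT, Nat.sub_self, headSum_zero,
      show i + 1 - i - 1 = 0 by omega]
    ring
  · rw [if_pos (by omega), if_pos (by omega), if_neg (by omega)]
    push_cast
    ring

/-- The head weight `u` stays arbitrary because removing the first block replaces it by `v`. -/
theorem surplusSum_sub_surplusSum (hw : ∀ i : ℕ, (i : R) * w (i + 1) = (i + 1) * v (i + 1))
    (n a : ℕ) (ha : a < n) :
    surplusSum u v (n + 1) a - surplusSum u v (n + 1) (a + 1) =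
      headSum u v (n + 1) - headSum u v (a + 1) * surplusSum w v (n - a) 0 := by
  induction n using Nat.strong_induction_on generalizing u a with
  | _ n ih =>
    refine surplusSum_sub_surplusSum_of_tail u hw n a ha fun i hi => ?_
    have h := ih (n - i - 1) (by omega) v (a - i - 1) (by omega)
    rwa [show n - i - 1 + 1 = n - i by omega, show a - i - 1 + 1 = a - i by omega,
      show n - i - 1 - (a - i - 1) = n - a by omega] at h

end Compositions

/-! ### The recursive surplus agrees with Θ⁺. -/

section Surplus

/-- The least partial sum of a list that is at least `a`. -/
noncomputable def leastPartialSum (t : List ℕ) (a : ℕ) : ℕ :=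
  sInf {s | ∃ k ≤ t.length, s = (t.take k).sum ∧ a ≤ s}

/-- Positivity of `a` excludes the empty partial sum, which `surplus` ignores. -/
theorem leastPartialSum_eq_surplus (t : List ℕ) (a : ℕ) (ha : 0 < a) (hat : a ≤ t.sum) :
    (leastPartialSum t a : ℤ) = a + surplus t a := by
  induction t generalizing a with
  | nil => simp at hat; omega
  | cons i t ih =>
    rw [List.sum_cons] at hat
    rw [surplus]
    split_ifs with h
    · have : leastPartialSum (i :: t) a = i := by
        refine IsLeast.csInf_eq ⟨⟨1, by simp, by simp, h⟩, ?_⟩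
        rintro s ⟨k, -, rfl, hk⟩
        cases k with
        | zero => simp at hk; omega
        | succ k => simp
      rw [this]; ring
    · have : leastPartialSum (i :: t) a = i + leastPartialSum t (a - i) := by
        have hne : {s | ∃ k ≤ t.length, s = (t.take k).sum ∧ a - i ≤ s}.Nonempty :=
          ⟨t.sum, t.length, le_rfl, by simp, by omega⟩
        obtain ⟨k, hk, hks, hka⟩ := Nat.sInf_mem hne
        refine IsLeast.csInf_eq ⟨⟨k + 1, by simpa using hk, ?_, ?_⟩, ?_⟩
        · rw [List.take_succ_cons, List.sum_cons, ← hks]; rfl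
        · unfold leastPartialSum; omega
        · rintro s ⟨k, hk, rfl, hk'⟩
          cases k with
          | zero => simp at hk'; omega
          | succ k =>
            rw [List.take_succ_cons, List.sum_cons] at hk' ⊢
            have h : leastPartialSum t (a - i) ≤ (t.take k).sum :=
              Nat.sInf_le ⟨k, by simpa using hk, rfl, by omega⟩
            omega
      rw [this]
      push_cast
      rw [ih (a - i) (by omega) (by omega)]
      omega

theorem ThetaPlus_eq_surplus {n : ℕ} (I : Composition n) (a : ℕ) (ha : 0 < a) (han : a ≤ n) :
    ThetaPlus I a = surplus I.blocks a := by
  have h := leastPartialSum_eq_surplus I.blocks a ha (by rwa [I.blocks_sum])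
  rw [ThetaPlus, show sigmaPlus I a = leastPartialSum I.blocks a from rfl, h]
  ring

end Surplus
end ChromSym

namespace ChromSym
-- Generating functions for paths, and the formula in finitely many variables.
section GeneratingFunctions
open PowerSeries
variable {R : Type*} [CommRing R]

theorem derivative_prod_one_add {α : Type*} [DecidableEq α] (x : α → R) (s : Finset α) :
    derivative R (∏ a ∈ s, (1 + C (x a) * X)) =
      ∑ a ∈ s, C (x a) * ∏ b ∈ s.erase a, (1 + C (x b) * X) := by
  induction s using Finset.induction_on with
  | empty => simp
  | insert c s hc ih =>
    have hd : derivative R (1 + C (x c) * X) = C (x c) := by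
      simp [Derivation.leibniz, derivative_C]
    rw [Finset.prod_insert hc, Derivation.leibniz, hd, ih, Finset.sum_insert hc,
      Finset.erase_insert hc, smul_eq_mul, smul_eq_mul, Finset.mul_sum, add_comm, mul_comm]
    congr 1
    refine Finset.sum_congr rfl fun a ha => ?_
    have hac : a ≠ c := fun h => hc (h ▸ ha)
    rw [Finset.erase_insert_of_ne hac.symm, Finset.prod_insert (by simp [hc])]
    ring

variable {α : Type*} [Fintype α]

/-- The generating function `∏ₐ (1 + xₐ X)` of the elementary symmetric polynomials in `x`. -/
noncomputable def elemSeries (x : α → R) : PowerSeries R := ∏ a, (1 + C (x a) * X)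

/-- The elementary symmetric polynomial of degree `k`, evaluated at `x`. -/
noncomputable def elemEval (x : α → R) (k : ℕ) : R := coeff k (elemSeries x)

variable (x : α → R)

theorem elemEval_zero : elemEval x 0 = 1 := by
  simp [elemEval, elemSeries, coeff_zero_eq_constantCoeff, map_prod]

theorem elemEval_eq_sum_powersetCard (k : ℕ) :
    elemEval x k = ∑ t ∈ Finset.powersetCard k Finset.univ, ∏ a ∈ t, x a := by
  classical
  rw [elemEval, elemSeries, Finset.prod_one_add, map_sum]
  have h : ∀ t : Finset α, coeff k (∏ a ∈ t, (C (x a) * X)) =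
      if t.card = k then ∏ a ∈ t, x a else 0 := by
    intro t
    rw [Finset.prod_mul_distrib, ← map_prod, Finset.prod_const, coeff_C_mul, coeff_X_pow]
    simp only [@eq_comm _ k, mul_ite, mul_one, mul_zero]
  simp only [h]
  rw [← Finset.sum_filter]
  refine Finset.sum_congr ?_ fun _ _ => rfl
  ext t
  simp [Finset.mem_powersetCard]

theorem wList_cons (i : ℕ) (t : List ℕ) :
    wList (i :: t) = i * (t.map fun j : ℕ => (j : ℤ) - 1).prod := by
  simp [wList, ← List.map_eq_flatMap, Function.comp_def]

theorem headProd_elemEval (t : List ℕ) :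
    headProd (fun i => (i : R) * elemEval x i) (fun i => ((i : R) - 1) * elemEval x i) t =
      (wList t : R) * (t.map (elemEval x)).prod := by
  cases t with
  | nil => simp [headProd, wList]
  | cons i t =>
    rw [headProd, wList_cons, List.prod_map_mul, Int.cast_mul, Int.cast_natCast,
      Int.cast_list_prod, List.map_map, List.map_cons, List.prod_cons]
    simp only [Function.comp_def, Int.cast_sub, Int.cast_natCast, Int.cast_one]
    ring

variable [DecidableEq α]

theorem derivative_elemSeries :
    derivative R (elemSeries x) =
      ∑ a, C (x a) * ∏ b ∈ Finset.univ.erase a, (1 + C (x b) * X) :=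
  derivative_prod_one_add x _

theorem mk_walkWeight_mul (a : α) :
    mk (fun k => walkWeight x k a) * (1 + C (x a) * X) = mk (pathSum x) := by
  ext k
  rw [mul_add, mul_one, mul_left_comm, map_add, coeff_C_mul]
  cases k with
  | zero => simp [walkWeight, pathSum]
  | succ k =>
    rw [coeff_succ_mul_X, coeff_mk, coeff_mk, coeff_mk, walkWeight_succ]
    ring

theorem mk_pathSum :
    mk (pathSum x) = 1 + ∑ a, C (x a) * (mk (fun k => walkWeight x k a) * X) := by
  ext k
  rw [map_add, map_sum]
  simp only [coeff_C_mul]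
  cases k with
  | zero => simp [pathSum]
  | succ k => simp [coeff_succ_mul_X, pathSum, coeff_one]

/-- Since W_a (1 + x_a z) = P, multiplying P = 1 + z ∑ x_a W_a by E turns the sum into z P E'. -/
theorem mk_pathSum_mul :
    mk (pathSum x) * (elemSeries x - X * derivative R (elemSeries x)) = elemSeries x := by
  have h : ∀ a, C (x a) * (mk (fun k => walkWeight x k a) * X) * elemSeries x =
      X * mk (pathSum x) * (C (x a) * ∏ b ∈ Finset.univ.erase a, (1 + C (x b) * X)) := by
    intro a
    rw [elemSeries, ← Finset.mul_prod_erase _ _ (Finset.mem_univ a), ← mk_walkWeight_mul x a]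
    ring
  have h' : mk (pathSum x) * elemSeries x =
      elemSeries x + X * mk (pathSum x) * derivative R (elemSeries x) := by
    conv_lhs => rw [mk_pathSum]
    rw [add_mul, one_mul, Finset.sum_mul, derivative_elemSeries, Finset.mul_sum]
    simp only [h]
  linear_combination h'

theorem mk_headSum (u v : ℕ → R) :
    mk (headSum u v) = 1 + X * (mk (fun i => u (i + 1)) * mk (headSum v v)) := by
  ext n
  cases n with
  | zero => simp [headSum_zero]
  | succ n =>
    rw [coeff_mk, headSum_succ, map_add, coeff_succ_X_mul, coeff_mul,
      Finset.Nat.sum_antidiagonal_eq_sum_range_succ_mk]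
    simp [coeff_one]

theorem pathSum_eq_headSum (n : ℕ) :
    pathSum x n = headSum (fun i => i * elemEval x i) (fun i => (i - 1) * elemEval x i) n := by
  set u : ℕ → R := fun i => i * elemEval x i with hu
  set v : ℕ → R := fun i => (i - 1) * elemEval x i with hv
  have hE : mk (fun i => u (i + 1)) = derivative R (elemSeries x) := by
    ext i
    rw [coeff_mk, coeff_derivative]
    simp only [hu, elemEval]
    push_cast
    ring
  -- Thus E - zE' = 1 - ∑ (i-1) e_i z^i, whose inverse is the series of `headSum v v`.
  have hd : elemSeries x - X * derivative R (elemSeries x) = 1 - X * mk (fun i => v (i + 1)) := by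
    ext i
    rw [map_sub, map_sub]
    cases i with
    | zero => simpa [elemEval] using elemEval_zero x
    | succ i =>
      rw [coeff_succ_X_mul, coeff_succ_X_mul, coeff_derivative, coeff_mk]
      simp [coeff_one, hv, elemEval]
      ring
  have hV := mk_headSum v v
  have hU := mk_headSum u v
  have hP := mk_pathSum_mul x
  rw [hE] at hU
  have hVd : mk (headSum v v) * (elemSeries x - X * derivative R (elemSeries x)) = 1 := by
    rw [hd]
    linear_combination hV
  have key : mk (pathSum x) = mk (headSum u v) := by
    rw [hU]
    linear_combination mk (headSum v v) * hP + (1 - mk (pathSum x)) * hVd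
  simpa using congrArg (coeff n) key

theorem tadpoleSum_eq_surplusSum (m l : ℕ) :
    tadpoleSum x m l =
      surplusSum (fun i => i * elemEval x i) (fun i => (i - 1) * elemEval x i) (m + l + 1) l := by
  induction m generalizing l with
  | zero => rw [tadpoleSum_zero, zero_add, surplusSum_self]
  | succ m ih =>
    have h := surplusSum_sub_surplusSum (fun i => i * elemEval x i)
      (v := fun i => (i - 1) * elemEval x i) (w := fun i => i * elemEval x i)
      (fun i => by push_cast; ring) (m + l + 1) l (by omega)
    rw [← pathSum_eq_headSum, ← pathSum_eq_headSum, show m + l + 1 - l = m + 0 + 1 by omega,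
      ← ih 0, show m + l + 1 + 1 = m + (l + 1) + 1 by ring, ← ih (l + 1)] at h
    rw [tadpoleSum_succ, show m + 1 + l + 1 = m + (l + 1) + 1 by ring]
    rw [show m + (l + 1) + 1 = m + l + 2 by ring] at h ⊢
    linear_combination -h

theorem tadpoleSum_eq_sum_composition (m l : ℕ) :
    tadpoleSum x m l = ∑ I : Composition (m + l + 1),
      ((ThetaPlus I (l + 1) * w I : ℤ) : R) * (I.blocks.map (elemEval x)).prod := by
  rw [tadpoleSum_eq_surplusSum, surplusSum]
  refine Finset.sum_congr rfl fun I _ => ?_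
  rw [headProd_elemEval, ThetaPlus_eq_surplus I _ (by omega) (by omega), w]
  push_cast
  ring

end GeneratingFunctions
end ChromSym

namespace ChromSym
-- Proper colorings of the tadpole as pairs of words.
section Colorings
variable {α R : Type*} [Fintype α] [CommRing R]

/-- The sum of the weights of the proper colorings of `G` with colors in `α`. -/
noncomputable def colorSum {V : Type*} [Fintype V] [DecidableEq V] (G : SimpleGraph V) (x : α → R) : R :=
  open scoped Classical in
  ∑ κ : V → α, if ∀ u v, G.Adj u v → κ u ≠ κ v then ∏ v, x (κ v) else 0

/-- A word without equal consecutive letters. -/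
def IsProperWord {β : Type*} {k : ℕ} (κ : Fin (k + 1) → β) : Prop :=
  ∀ i : Fin k, κ i.castSucc ≠ κ i.succ

theorem isProperWord_cons_cons {β : Type*} {k : ℕ} (a b : β) (κ : Fin k → β) :
    IsProperWord (Fin.cons a (Fin.cons b κ : Fin (k + 1) → β) : Fin (k + 2) → β) ↔
      a ≠ b ∧ IsProperWord (Fin.cons b κ : Fin (k + 1) → β) := by
  simp only [IsProperWord, Fin.forall_fin_succ (n := k), Fin.castSucc_zero, Fin.cons_zero,
    Fin.cons_succ, Fin.castSucc_succ]

theorem isProperWord_cons_iff {β : Type*} {l : ℕ} (a : β) (κ : Fin l → β) :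
    IsProperWord (Fin.cons a κ : Fin (l + 1) → β) ↔
      (∀ j : Fin l, j.val = 0 → a ≠ κ j) ∧ ∀ i j : Fin l, i.val + 1 = j.val → κ i ≠ κ j := by
  constructor
  · intro h
    refine ⟨fun j hj => ?_, fun i j hij => ?_⟩
    · have hj' : j.castSucc = 0 := Fin.ext hj
      simpa [hj'] using h j
    · have hj' : j.castSucc = i.succ := Fin.ext (by simp [hij])
      simpa [hj'] using h j
  · rintro ⟨h0, h⟩ j
    rw [Fin.cons_succ]
    rcases Fin.eq_zero_or_eq_succ j.castSucc with hj | ⟨i, hi⟩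
    · rw [hj, Fin.cons_zero]
      exact h0 j (by simpa using congrArg Fin.val hj)
    · rw [hi, Fin.cons_succ]
      exact h i j (by simpa using (congrArg Fin.val hi).symm)

theorem sum_fin_succ_arrow (k : ℕ) (F : (Fin (k + 1) → α) → R) :
    ∑ κ, F κ = ∑ a, ∑ κ : Fin k → α, F (Fin.cons a κ : Fin (k + 1) → α) := by
  rw [← (Fin.consEquiv fun _ => α).sum_comp, Fintype.sum_prod_type]
  rfl

theorem sum_sum_arrow {ι ι' : Type*} [Fintype ι] [Fintype ι'] [DecidableEq ι] [DecidableEq ι']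
    (F : (ι ⊕ ι' → α) → R) :
    ∑ κ, F κ = ∑ κ : ι → α, ∑ τ : ι' → α, F (Sum.elim κ τ) := by
  rw [← (Equiv.sumArrowEquivProdArrow ι ι' α).symm.sum_comp, Fintype.sum_prod_type]
  rfl

open scoped Classical in
theorem walkWeight_eq_sum [DecidableEq α] (x : α → R) (k : ℕ) (a : α) :
    walkWeight x k a = ∑ κ : Fin k → α,
      if IsProperWord (Fin.cons a κ : Fin (k + 1) → α) then ∏ i, x (κ i) else 0 := by
  induction k generalizing a with
  | zero => simp [walkWeight, IsProperWord]
  | succ k ih =>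
    rw [walkWeight, sum_fin_succ_arrow]
    refine Finset.sum_congr rfl fun b _ => ?_
    simp only [isProperWord_cons_cons, ih, Fin.prod_univ_succ, Fin.cons_zero, Fin.cons_succ,
      Finset.mul_sum]
    by_cases h : a = b <;> simp [h]

open scoped Classical in
theorem loopWeight_eq_sum [DecidableEq α] (x : α → R) (k : ℕ) (a b : α) :
    loopWeight x k a b = ∑ κ : Fin k → α,
      if IsProperWord (Fin.cons a κ : Fin (k + 1) → α) ∧
        (Fin.cons a κ : Fin (k + 1) → α) (Fin.last k) ≠ b then ∏ i, x (κ i) else 0 := by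
  induction k generalizing a with
  | zero => simp [loopWeight, IsProperWord]
  | succ k ih =>
    rw [loopWeight, sum_fin_succ_arrow]
    refine Finset.sum_congr rfl fun c _ => ?_
    simp only [isProperWord_cons_cons, ih, Fin.prod_univ_succ, Fin.cons_zero, Fin.cons_succ,
      Finset.mul_sum, ← Fin.succ_last]
    by_cases h : a = c <;> simp [h]

theorem forall_cycleGraph_adj_ne_iff {β : Type*} (k : ℕ) (κ : Fin (k + 2) → β) :
    (∀ u v, (SimpleGraph.cycleGraph (k + 2)).Adj u v → κ u ≠ κ v) ↔
      IsProperWord κ ∧ κ (Fin.last (k + 1)) ≠ κ 0 := by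
  simp only [SimpleGraph.cycleGraph_adj]
  constructor
  · refine fun h => ⟨fun i => h _ _ (Or.inr ?_), h _ _ (Or.inr ?_)⟩
    · rw [← Fin.coeSucc_eq_succ, add_sub_cancel_left]
    · rw [sub_eq_iff_eq_add', Fin.last_add_one]
  · rintro ⟨h, h0⟩
    have key : ∀ u v : Fin (k + 2), u - v = 1 → κ v ≠ κ u := by
      intro u v huv
      obtain rfl := sub_eq_iff_eq_add'.mp huv
      rcases Fin.eq_castSucc_or_eq_last v with ⟨i, rfl⟩ | rfl
      · rw [Fin.coeSucc_eq_succ]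
        exact h i
      · rw [Fin.last_add_one]
        exact h0
    exact fun u v huv => huv.elim (fun e => (key u v e).symm) (key v u)

theorem forall_tadpole_adj_ne_iff {β : Type*} (k l : ℕ) (κ : Fin (k + 2) → β) (τ : Fin l → β) :
    (∀ u v, (tadpole (k + 2) l).Adj u v → Sum.elim κ τ u ≠ Sum.elim κ τ v) ↔
      (IsProperWord κ ∧ κ (Fin.last (k + 1)) ≠ κ 0) ∧
        IsProperWord (Fin.cons (κ 0) τ : Fin (l + 1) → β) := by
  rw [← forall_cycleGraph_adj_ne_iff, isProperWord_cons_iff]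
  constructor
  · refine fun h => ⟨fun u v huv => h (Sum.inl u) (Sum.inl v) (Or.inl (by simpa using huv)),
      fun j hj => h (Sum.inl 0) (Sum.inr j) (Or.inr ?_),
      fun i j hij => h (Sum.inr i) (Sum.inr j) (Or.inl ?_)⟩
    · rw [SimpleGraph.fromRel_adj]
      exact ⟨by simp, Or.inl ⟨0, j, rfl, hj, rfl, rfl⟩⟩
    · simpa [SimpleGraph.pathGraph_adj] using Or.inl hij
  · rintro ⟨hc, h0, hp⟩ u v (huv | huv)
    · rcases u with u | u <;> rcases v with v | v
      · exact hc u v (by simpa using huv)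
      · simp at huv
      · simp at huv
      · have huv' : u.val + 1 = v.val ∨ v.val + 1 = u.val := by
          simpa [SimpleGraph.pathGraph_adj] using huv
        exact huv'.elim (hp u v) fun h => (hp v u h).symm
    · rw [SimpleGraph.fromRel_adj] at huv
      obtain ⟨-, ⟨i, j, hi, hj, rfl, rfl⟩ | ⟨i, j, hi, hj, rfl, rfl⟩⟩ := huv
      · obtain rfl : i = 0 := Fin.ext hi
        exact h0 j hj
      · obtain rfl : i = 0 := Fin.ext hi
        exact (h0 j hj).symm

/-- The color of the junction is the base letter; the other k+1 cycle vertices form the loop and the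
tail forms the walk. -/
theorem colorSum_tadpole [DecidableEq α] (x : α → R) (k l : ℕ) :
    colorSum (tadpole (k + 2) l) x = tadpoleSum x (k + 1) l := by
  classical
  rw [colorSum, sum_sum_arrow, sum_fin_succ_arrow, tadpoleSum]
  refine Finset.sum_congr rfl fun a _ => ?_
  rw [loopWeight_eq_sum, walkWeight_eq_sum, mul_assoc, Finset.sum_mul_sum, Finset.mul_sum]
  refine Finset.sum_congr rfl fun κ _ => ?_
  rw [Finset.mul_sum]
  refine Finset.sum_congr rfl fun τ _ => ?_
  have h := forall_tadpole_adj_ne_iff k l (Fin.cons a κ : Fin (k + 2) → α) τ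
  rw [Fin.cons_zero] at h
  simp only [h, Fintype.prod_sum_type, Fin.prod_univ_succ (n := k + 1), ite_and, Sum.elim_inl,
    Sum.elim_inr, Fin.cons_zero, Fin.cons_succ]
  split_ifs <;> ring

end Colorings

/-! ### Reduction to finitely many variables, one coefficient at a time. -/

section Coefficients
open MvPowerSeries

theorem prod_X_eq_monomial {ι : Type*} (s : Finset ι) (f : ι → ℕ) :
    ∏ i ∈ s, (X (f i) : MvPowerSeries ℕ ℚ) = monomial (∑ i ∈ s, Finsupp.single (f i) 1) 1 := by
  classical
  induction s using Finset.induction_on with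
  | empty => simp
  | insert c s hc ih =>
    rw [Finset.prod_insert hc, Finset.sum_insert hc, ih, X, monomial_mul_monomial, one_mul]

/-- A coloring with monomial x^d only uses colors in the support of `d`. -/
theorem coeff_chromaticSymm {V : Type*} [Fintype V] [DecidableEq V] (G : SimpleGraph V) (d : ℕ →₀ ℕ) :
    coeff d (chromaticSymm G) =
      coeff d (colorSum G fun a : d.support => (X a.1 : MvPowerSeries ℕ ℚ)) := by
  classical
  have h : coeff d (colorSum G fun a : d.support => (X a.1 : MvPowerSeries ℕ ℚ)) =
      ∑ κ : V → d.support,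
        if (∀ u v, G.Adj u v → κ u ≠ κ v) ∧ ∑ v, Finsupp.single (κ v).1 1 = d then 1 else 0 := by
    rw [colorSum, map_sum]
    refine Finset.sum_congr rfl fun κ _ => ?_
    rw [ite_and]
    split_ifs with h₁ h₂
    · rw [prod_X_eq_monomial, coeff_monomial, if_pos h₂.symm]
    · rw [prod_X_eq_monomial, coeff_monomial, if_neg (Ne.symm h₂)]
    · simp
  have hmem : ∀ κ : {κ : G.Coloring ℕ // ∑ v, Finsupp.single (κ v) 1 = d}, ∀ v,
      κ.1 v ∈ d.support := by
    rintro ⟨κ, rfl⟩ v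
    rw [Finsupp.mem_support_iff, Finsupp.finsetSum_apply]
    refine (Finset.sum_pos' (fun _ _ => Nat.zero_le _) ⟨v, Finset.mem_univ v, ?_⟩).ne'
    simp
  rw [h, Finset.sum_boole,
    ← Fintype.card_subtype, ← Nat.card_eq_fintype_card]
  refine congrArg Nat.cast (Nat.card_congr ?_)
  exact
    { toFun := fun κ => ⟨fun v => ⟨κ.1 v, hmem κ v⟩,
        fun u v huv e => κ.1.valid huv (congrArg Subtype.val e), κ.2⟩
      invFun := fun κ => ⟨SimpleGraph.Coloring.mk (fun v => (κ.1 v).1)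
        fun huv e => κ.2.1 _ _ huv (Subtype.ext e), κ.2.2⟩
      left_inv := fun κ => rfl
      right_inv := fun κ => rfl }

theorem support_sum_single (s : Finset ℕ) :
    (∑ i ∈ s, Finsupp.single i 1 : ℕ →₀ ℕ).support = s := by
  ext j
  simp [Finsupp.finsetSum_apply, Finsupp.single_apply]

theorem coeff_elemSymm (S : Finset ℕ) (k : ℕ) (d : ℕ →₀ ℕ) (hd : d.support ⊆ S) :
    coeff d (elemSymm k) = coeff d (elemEval (fun a : S => (X a.1 : MvPowerSeries ℕ ℚ)) k) := by
  classical
  have h : elemEval (fun a : S => (X a.1 : MvPowerSeries ℕ ℚ)) k =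
      ∑ s ∈ Finset.powersetCard k S, monomial (∑ i ∈ s, Finsupp.single i 1) 1 := by
    rw [elemEval_eq_sum_powersetCard]
    conv_rhs => rw [← Finset.attach_map_val (s := S), Finset.powersetCard_map, Finset.sum_map]
    exact Finset.sum_congr rfl fun t _ => by simp [prod_X_eq_monomial]
  rw [h, map_sum]
  simp only [coeff_monomial]
  change (if _ then (1 : ℚ) else 0) = _
  split_ifs with hs
  · obtain ⟨s, rfl, rfl⟩ := hs
    rw [support_sum_single] at hd
    rw [Finset.sum_eq_single s, if_pos rfl]
    · intro t _ hts
      refine if_neg fun e => hts ?_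
      rw [← support_sum_single t, ← e, support_sum_single]
    · intro hs
      exact absurd (Finset.mem_powersetCard.mpr ⟨hd, rfl⟩) hs
  · refine (Finset.sum_eq_zero fun s hs' => if_neg fun e => hs ⟨s, ?_, e⟩).symm
    exact (Finset.mem_powersetCard.mp hs').2

/-- Both parts of a splitting of `d` are again supported in `S`, so the one-factor case applies to
each factor. -/
theorem coeff_prod_elemSymm (S : Finset ℕ) (t : List ℕ) (d : ℕ →₀ ℕ) (hd : d.support ⊆ S) :
    coeff d (t.map elemSymm).prod =
      coeff d (t.map (elemEval fun a : S => (X a.1 : MvPowerSeries ℕ ℚ))).prod := by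
  classical
  induction t generalizing d with
  | nil => rfl
  | cons i t ih =>
    rw [List.map_cons, List.map_cons, List.prod_cons, List.prod_cons, coeff_mul, coeff_mul]
    refine Finset.sum_congr rfl fun p hp => ?_
    have hp' : p.1 + p.2 = d := by simpa using hp
    rw [coeff_elemSymm S, ih]
    · exact (Finsupp.support_mono (hp' ▸ le_add_self)).trans hd
    · exact (Finsupp.support_mono (hp' ▸ le_self_add)).trans hd

end Coefficients
end ChromSym

theorem mainTheorem3 (n l : ℕ) (h : l + 2 ≤ n) :
    ChromSym.chromaticSymm (ChromSym.tadpole (n - l) l) =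
      ∑ I : Composition n,
        ((ChromSym.ThetaPlus I (l + 1) * ChromSym.w I : ℤ) : ℚ) • ChromSym.elemSymmComp I := by
  obtain ⟨k, rfl⟩ : ∃ k, n = k + 1 + l + 1 := ⟨n - l - 2, by omega⟩
  rw [show k + 1 + l + 1 - l = k + 2 by omega]
  ext d
  rw [ChromSym.coeff_chromaticSymm, ChromSym.colorSum_tadpole,
    ChromSym.tadpoleSum_eq_sum_composition, map_sum, map_sum]
  refine Finset.sum_congr rfl fun I _ => ?_
  rw [MvPowerSeries.coeff_smul, ChromSym.elemSymmComp,
    ChromSym.coeff_prod_elemSymm d.support _ d subset_rfl,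
    ← map_intCast (MvPowerSeries.C (σ := ℕ) (R := ℚ)), MvPowerSeries.coeff_C_mul]
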